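/- Let $\mathbb{K}=\mathbb{R}$ or $\mathbb{C}$, let $m\ge 1$ be an integer, $p_1,\ldots,p_m\in[1,\infty]$ (with $1/\infty:=0$), let $E$ be a Banach space over $\mathbb{K}$, let $F$ be a Banach space over $\mathbb{K}$ of cotype $q$ (where $2\le q<\infty$), and let $1\le r\le q$ be such that $$\frac1r-\frac1q\le \frac1{p_1}+\cdots+\frac1{p_m}<\frac1r .$$ Put $k_0:=\max\left\{t\in\{1,\ldots,m\}:\ \frac1{p_t}+\cdots+\frac1{p_m}\ge\frac1r-\frac1q\right\}$ (this set contains $1$) and $$s_k=\begin{cases}\left[\dfrac1r-\left(\dfrac1{p_k}+\cdots+\dfrac1{p_m}\right)\right]^{-1}, & k\le k_0,\\[2mm] q, & k>k_0.\end{cases}$$ Then there is a constant $C_m$ (independent of $n$, $A$ and $v$) such that $$\left(\sum_{j_1=1}^n\left(\cdots\left(\sum_{j_m=1}^n\left\Vert vA(e_{j_1},\ldots,e_{j_m})\right\Vert_F^{s_m}\right)^{\frac{s_{m-1}}{s_m}}\cdots\right)^{\frac{s_1}{s_2}}\right)^{\frac1{s_1}}\le C_m\,\|A\|\,\pi_{r,1}(v)$$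 for all $n$, all $m$-linear operators $A\colon \ell_{p_1}^n\times\cdots\times\ell_{p_m}^n\to E$ and all absolutely $(r,1)$-summing operators $v\colon E\to F$. Here $F$ has cotype $q$ if there is a constant $C$ with $\left(\sum_{k=1}^{N}\|x_k\|^q\right)^{1/q}\le C\left(2^{-N}\sum_{\varepsilon\in\{-1,1\}^N}\left\|\sum_{k=1}^{N}\varepsilon_kx_k\right\|^2\right)^{1/2}$ for all $N$ and all $x_1,\ldots,x_N\in F$. A bounded linear operator $v\colon E\to F$ is absolutely $(r,1)$-summing if there is a constant $C\ge0$ with $\left(\sum_{j=1}^{N}\|v(x_j)\|^r\right)^{1/r}\le C\sup_{\varphi\in B_{E^*}}\sum_{j=1}^{N}|\varphi(x_j)|$ for all $N$ and all $x_1,\ldots,x_N\in E$, and $\pi_{r,1}(v)$ is the infimum of such $C$. -/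

import Mathlib

open scoped ENNReal

noncomputable section

/-- The Banach space `F` has (Rademacher) cotype `q`, where `2 ≤ q < ∞`:
`(∑ ‖x_k‖^q)^(1/q) ≤ C (𝔼 ‖∑ ε_k x_k‖²)^(1/2)` for all finite families, where the `ε_k` are
independent uniformly distributed signs. -/
def HasCotype (q : ℝ) (F : Type*) [NormedAddCommGroup F] : Prop :=
  2 ≤ q ∧ ∃ C : ℝ, ∀ (n : ℕ) (x : Fin n → F),
    (∑ k, ‖x k‖ ^ q) ^ (1 / q) ≤
      C * Real.sqrt ((1 / 2 ^ n) * ∑ ε : Fin n → ℤˣ, ‖∑ k, ε k • x k‖ ^ 2)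

section Summing

variable {𝕜 : Type*} [RCLike 𝕜] {E F : Type*} [NormedAddCommGroup E] [NormedSpace 𝕜 E]
  [NormedAddCommGroup F] [NormedSpace 𝕜 F]

/-- The weak `ℓ_p` norm of a finite family: the supremum, over the closed unit ball of the
topological dual of `E`, of `(∑ |φ(x_j)|^p)^(1/p)`. -/
def weakNorm (𝕜 : Type*) [RCLike 𝕜] {E : Type*} [NormedAddCommGroup E] [NormedSpace 𝕜 E]
    (p : ℝ) {n : ℕ} (x : Fin n → E) : ℝ :=
  ⨆ φ : Metric.closedBall (0 : E →L[𝕜] 𝕜) 1, (∑ j, ‖φ.1 (x j)‖ ^ p) ^ (1 / p)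

/-- The constants `C ≥ 0` that are admissible in the definition of an absolutely
`(r, p)`-summing operator. -/
def summingConstants (r p : ℝ) (v : E →L[𝕜] F) : Set ℝ :=
  {C : ℝ | 0 ≤ C ∧ ∀ (n : ℕ) (x : Fin n → E),
    (∑ j, ‖v (x j)‖ ^ r) ^ (1 / r) ≤ C * weakNorm 𝕜 p x}

/-- `v` is absolutely `(r, p)`-summing. -/
def IsAbsolutelySumming (r p : ℝ) (v : E →L[𝕜] F) : Prop :=
  (summingConstants r p v).Nonempty

/-- The absolutely `(r, p)`-summing norm `π_{r,p}(v)`. -/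
def summingNorm (r p : ℝ) (v : E →L[𝕜] F) : ℝ :=
  sInf (summingConstants r p v)

end Summing

/-- The mixed norm
`(∑_{j₁} ( ⋯ (∑_{j_m} a(j₁,…,j_m)^{s_m})^{s_{m-1}/s_m} ⋯ )^{s₁/s₂})^{1/s₁}`
of a family of nonnegative reals indexed by `{1,…,n}^m`; the sum over the last index is the
innermost one. -/
def mixedNorm {n : ℕ} : (m : ℕ) → (Fin m → ℝ) → ((Fin m → Fin n) → ℝ) → ℝ
  | 0, _, a => a Fin.elim0
  | m + 1, s, a =>
      (∑ j : Fin n, mixedNorm m (Fin.tail s) (fun js => a (Fin.cons j js)) ^ s 0) ^ (1 / s 0)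

/-- The tail sum `1/p_k + ⋯ + 1/p_m`, with `1/∞ = 0`. -/
def tailSum {m : ℕ} (p : Fin m → ℝ≥0∞) (k : Fin m) : ℝ :=
  ∑ j ∈ Finset.Ici k, ((p j)⁻¹).toReal

/-- The exponents `s_k = [1/r - (1/p_k + ⋯ + 1/p_m)]⁻¹` for `k ≤ k₀` and `s_k = q` for
`k > k₀`. -/
def hlExponent {m : ℕ} (p : Fin m → ℝ≥0∞) (r q : ℝ) (k₀ k : Fin m) : ℝ :=
  if k ≤ k₀ then (1 / r - tailSum p k)⁻¹ else q

end

/-! Evaluating A on vectors with entries ±μ_l(j), where μ_l lies in the unit ball of ℓ_{p_l}, and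
summing in ℓ_r over one chosen coordinate, the (r,1)-summing property bounds signed, weighted sums
of the coefficients vA(e_J); this is `SignSummable`. The rest concerns coefficient families in F
only.

Cotype removes the signs. Since r may be less than 2, cotype is needed with the first Rademacher
moment, which `kahane_inequality` supplies; averaging over the signs gives (r,q) mixed bounds with
any coordinate outermost.

Uniformity in the weights raises exponents. If coordinate l is outermost, the converse of Hölder's
inequality turns u into t, 1/t = 1/u - 1/p_l. If another coordinate is outermost, Hardy–Littlewood
interpolation between weighted rows and columns gives the same gain while t ≤ q. This absorbs the
coordinates after k₀. Coordinate k₀ is itself outermost at that stage, so its exponent may pass q.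

The coordinates before k₀ are then added from the inside outwards. A mixed norm with decreasing
exponents at least q has the cotype of its outermost exponent (`CotypeOne.mixedNorm`), a signed
weighted sum over the new coordinate is a family of the same kind with one coordinate fewer, and the
converse of Hölder turns s_{k+1} into s_k. Each coordinate costs one factor C. -/

open scoped BigOperators

/-! ### Poincaré inequality on the discrete cube -/

section Cube

theorem sum_fin_cons {α M : Type*} [Fintype α] [AddCommMonoid M] {m : ℕ}
    (f : (Fin (m + 1) → α) → M) :
    ∑ J, f J = ∑ i, ∑ J : Fin m → α, f (Fin.cons i J) := by
  rw [← (Fin.consEquiv (fun _ : Fin (m + 1) => α)).sum_comp, Fintype.sum_prod_type]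
  rfl

theorem expect_fin_cons {α : Type*} [Fintype α] {m : ℕ} (f : (Fin (m + 1) → α) → ℝ) :
    𝔼 J, f J = 𝔼 i, 𝔼 J : Fin m → α, f (Fin.cons i J) := by
  simp only [Fintype.expect_eq_sum_div_card]
  rw [sum_fin_cons, ← Finset.sum_div, div_div]
  congr 1
  simp [pow_succ]

theorem expect_cube_succ {n : ℕ} (f : (Fin (n + 1) → ℤˣ) → ℝ) :
    𝔼 ε, f ε = 𝔼 ε : Fin n → ℤˣ, (f (Fin.cons 1 ε) + f (Fin.cons (-1) ε)) / 2 := by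
  rw [expect_fin_cons, Finset.expect_comm]
  refine Finset.expect_congr rfl fun ε _ => ?_
  rw [Fintype.expect_eq_sum_div_card]
  simp

/-- The Dirichlet form of the discrete cube. -/
noncomputable def cubeEnergy {n : ℕ} (f : (Fin n → ℤˣ) → ℝ) : ℝ :=
  ∑ k, 𝔼 ε, f ε * (f ε - f (Function.update ε k (-ε k))) / 2

theorem cubeEnergy_succ {n : ℕ} (f : (Fin (n + 1) → ℤˣ) → ℝ) :
    cubeEnergy f =
      cubeEnergy (fun ε => (f (Fin.cons 1 ε) + f (Fin.cons (-1) ε)) / 2) +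
      cubeEnergy (fun ε => (f (Fin.cons 1 ε) - f (Fin.cons (-1) ε)) / 2) +
      𝔼 ε, ((f (Fin.cons 1 ε) - f (Fin.cons (-1) ε)) / 2) ^ 2 := by
  unfold cubeEnergy
  rw [Fin.sum_univ_succ, add_comm, ← Finset.sum_add_distrib]
  congr 1
  · refine Finset.sum_congr rfl fun k _ => ?_
    rw [expect_cube_succ, ← Finset.expect_add_distrib]
    refine Finset.expect_congr rfl fun ε _ => ?_
    simp only [Fin.cons_succ, ← Fin.cons_update]
    ring
  · rw [expect_cube_succ]
    refine Finset.expect_congr rfl fun ε _ => ?_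
    simp only [Fin.cons_zero, Fin.update_cons_zero, neg_neg]
    ring

theorem neg_fin_cons {n : ℕ} (s : ℤˣ) (ε : Fin n → ℤˣ) :
    -(Fin.cons s ε : Fin (n + 1) → ℤˣ) = Fin.cons (-s) (-ε) := by
  funext i
  refine Fin.cases ?_ (fun j => ?_) i <;> simp

theorem expect_comp_neg {n : ℕ} (f : (Fin n → ℤˣ) → ℝ) : 𝔼 ε, f (-ε) = 𝔼 ε, f ε :=
  Fintype.expect_equiv (Equiv.neg _) _ _ fun _ => rfl

theorem sq_expect_le {ι : Type*} [Fintype ι] (f : ι → ℝ) : (𝔼 i, f i) ^ 2 ≤ 𝔼 i, f i ^ 2 := by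
  have h := Finset.expect_mul_sq_le_sq_mul_sq Finset.univ f (fun _ => (1 : ℝ))
  simp only [mul_one, one_pow] at h
  refine h.trans ?_
  rcases isEmpty_or_nonempty ι with hι | hι
  · simp
  · rw [Fintype.expect_one, mul_one]

/-- A Poincaré inequality on the cube with the improved constant on the even part. -/
theorem poincare_cube {n : ℕ} (f : (Fin n → ℤˣ) → ℝ) :
    3 / 2 * 𝔼 ε, f ε ^ 2 + 1 / 2 * 𝔼 ε, f ε * f (-ε) - 2 * (𝔼 ε, f ε) ^ 2 ≤ cubeEnergy f := by
  -- On the Walsh coefficient of a set S the claim reads 0, 1 or 2 ≤ |S|, for S empty, odd, or even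
  -- and nonempty.
  induction n with
  | zero =>
    have hf : ∀ ε, f ε = f default := fun ε => by rw [Subsingleton.elim ε default]
    simp only [hf, Fintype.expect_const, cubeEnergy, Finset.univ_eq_empty, Finset.sum_empty]
    nlinarith
  | succ n ih =>
    set g : (Fin n → ℤˣ) → ℝ := fun ε => (f (Fin.cons 1 ε) + f (Fin.cons (-1) ε)) / 2 with hg
    set h : (Fin n → ℤˣ) → ℝ := fun ε => (f (Fin.cons 1 ε) - f (Fin.cons (-1) ε)) / 2 with hh
    have e1 : cubeEnergy f = cubeEnergy g + cubeEnergy h + 𝔼 ε, h ε ^ 2 := cubeEnergy_succ f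
    have e2 : 𝔼 ε, f ε ^ 2 = 𝔼 ε, g ε ^ 2 + 𝔼 ε, h ε ^ 2 := by
      rw [expect_cube_succ, ← Finset.expect_add_distrib]
      refine Finset.expect_congr rfl fun ε _ => ?_
      simp only [hg, hh]
      ring
    have e3 : 𝔼 ε, f ε * f (-ε) = 𝔼 ε, g ε * g (-ε) - 𝔼 ε, h ε * h (-ε) := by
      rw [expect_cube_succ, ← Finset.expect_sub_distrib]
      refine Finset.expect_congr rfl fun ε _ => ?_
      simp only [hg, hh, neg_fin_cons, neg_neg]
      ring
    have e4 : 𝔼 ε, f ε = 𝔼 ε, g ε := expect_cube_succ f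
    -- The reflection term of `h` enters with reversed sign; Jensen for `h ε + h (-ε)` compensates
    -- for it.
    have e5 : (2 * 𝔼 ε, h ε) ^ 2 ≤ 2 * 𝔼 ε, h ε ^ 2 + 2 * 𝔼 ε, h ε * h (-ε) := by
      have h1 : 2 * 𝔼 ε, h ε = 𝔼 ε, (h ε + h (-ε)) := by
        rw [Finset.expect_add_distrib, expect_comp_neg]; ring
      have h2 : 𝔼 ε, (h ε + h (-ε)) ^ 2 = 2 * 𝔼 ε, h ε ^ 2 + 2 * 𝔼 ε, h ε * h (-ε) := by
        have h3 : 𝔼 ε, h ε ^ 2 = 𝔼 ε, h (-ε) ^ 2 := (expect_comp_neg fun ε => h ε ^ 2).symm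
        have h4 : 2 * 𝔼 ε, h ε ^ 2 = 𝔼 ε, h ε ^ 2 + 𝔼 ε, h (-ε) ^ 2 := by rw [← h3]; ring
        rw [h4, Finset.mul_expect, ← Finset.expect_add_distrib, ← Finset.expect_add_distrib]
        refine Finset.expect_congr rfl fun ε _ => ?_
        ring
      rw [h1, ← h2]
      exact sq_expect_le _
    have i1 := ih g
    have i2 := ih h
    rw [e1, e2, e3, e4]
    nlinarith

end Cube

/-! ### Kahane's inequality and cotype with the first moment -/

section Cotype

variable {F : Type*} [NormedAddCommGroup F] [NormedSpace ℝ F]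

/-- The Rademacher sum `∑ ε_k x_k`. -/
def signSum {n : ℕ} (ε : Fin n → ℤˣ) (x : Fin n → F) : F := ∑ k, ((ε k : ℤ) : ℝ) • x k

theorem signSum_update {n : ℕ} (ε : Fin n → ℤˣ) (x : Fin n → F) (k : Fin n) :
    signSum (Function.update ε k (-ε k)) x = signSum ε x - (2 : ℝ) • ((ε k : ℤ) : ℝ) • x k := by
  unfold signSum
  rw [← Finset.add_sum_erase _ _ (Finset.mem_univ k),
    ← Finset.add_sum_erase _ (fun k => ((ε k : ℤ) : ℝ) • x k) (Finset.mem_univ k)]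
  have : ∑ j ∈ Finset.univ.erase k, ((Function.update ε k (-ε k) j : ℤ) : ℝ) • x j =
      ∑ j ∈ Finset.univ.erase k, ((ε j : ℤ) : ℝ) • x j :=
    Finset.sum_congr rfl fun j hj => by rw [Function.update_of_ne (Finset.ne_of_mem_erase hj)]
  rw [this, Function.update_self, two_smul]
  push_cast
  rw [neg_smul]
  abel

/-- Kahane's inequality between the first and second moments, with the optimal constant. -/
theorem kahane_inequality {n : ℕ} (x : Fin n → F) :
    𝔼 ε, ‖signSum ε x‖ ^ 2 ≤ 2 * (𝔼 ε, ‖signSum ε x‖) ^ 2 := by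
  set f : (Fin n → ℤˣ) → ℝ := fun ε => ‖signSum ε x‖ with hf
  have hev : ∀ ε, f (-ε) = f ε := fun ε => by
    have : signSum (-ε) x = -signSum ε x := by simp [signSum]
    simp only [hf, this, norm_neg]
  have hp := poincare_cube f
  simp only [hev] at hp
  have hen : cubeEnergy f ≤ 𝔼 ε, f ε ^ 2 := by
    unfold cubeEnergy
    rw [← Finset.expect_sum_comm]
    refine Finset.expect_le_expect fun ε _ => ?_
    -- The n sign sums with one sign flipped add up to n - 2 times the original.
    have h1 : ((n : ℝ) - 2) * f ε ≤ ∑ k, f (Function.update ε k (-ε k)) := by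
      calc ((n : ℝ) - 2) * f ε ≤ |(n : ℝ) - 2| * f ε :=
            mul_le_mul_of_nonneg_right (le_abs_self _) (norm_nonneg _)
        _ = ‖((n : ℝ) - 2) • signSum ε x‖ := by rw [norm_smul, Real.norm_eq_abs]
        _ = ‖∑ k, signSum (Function.update ε k (-ε k)) x‖ := by
            simp only [signSum_update, Finset.sum_sub_distrib, ← Finset.smul_sum]
            rw [sub_smul, Finset.sum_const, Finset.card_univ, Fintype.card_fin, Nat.cast_smul_eq_nsmul]
            rfl
        _ ≤ _ := norm_sum_le _ _
    have h2 : ∑ k, f ε * (f ε - f (Function.update ε k (-ε k))) / 2 =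
        f ε * (n * f ε - ∑ k, f (Function.update ε k (-ε k))) / 2 := by
      rw [← Finset.sum_div, ← Finset.mul_sum, Finset.sum_sub_distrib]
      simp
    rw [h2]
    have h0 : 0 ≤ f ε := norm_nonneg _
    nlinarith
  have hs : 𝔼 ε, f ε * f ε = 𝔼 ε, f ε ^ 2 :=
    Finset.expect_congr rfl fun ε _ => (sq _).symm
  rw [hs] at hp
  change 𝔼 ε, f ε ^ 2 ≤ 2 * (𝔼 ε, f ε) ^ 2
  linarith

/-- Cotype `q` with the first Rademacher moment in place of the second one. -/
def CotypeOne (q C : ℝ) (F : Type*) [NormedAddCommGroup F] [NormedSpace ℝ F] : Prop :=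
  ∀ (n : ℕ) (x : Fin n → F), (∑ k, ‖x k‖ ^ q) ^ (1 / q) ≤ C * 𝔼 ε, ‖signSum ε x‖

theorem HasCotype.exists_cotypeOne {q : ℝ} (h : HasCotype q F) :
    ∃ C, 0 ≤ C ∧ CotypeOne q C F := by
  obtain ⟨-, C, hC⟩ := h
  refine ⟨|C| * √2, by positivity, fun n x => (hC n x).trans ?_⟩
  have e : (1 / 2 ^ n) * ∑ ε : Fin n → ℤˣ, ‖∑ k, ε k • x k‖ ^ 2 = 𝔼 ε, ‖signSum ε x‖ ^ 2 := by
    rw [Fintype.expect_eq_sum_div_card, one_div, mul_comm, ← div_eq_mul_inv]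
    congr 1
    · refine Finset.sum_congr rfl fun ε _ => ?_
      simp only [signSum, Units.smul_def, Int.cast_smul_eq_zsmul]
    · simp
  rw [e]
  have h0 : 0 ≤ 𝔼 ε, ‖signSum ε x‖ := Finset.expect_nonneg fun _ _ => norm_nonneg _
  calc C * √(𝔼 ε, ‖signSum ε x‖ ^ 2) ≤ |C| * √(2 * (𝔼 ε, ‖signSum ε x‖) ^ 2) :=
        mul_le_mul (le_abs_self _) (Real.sqrt_le_sqrt (kahane_inequality x)) (Real.sqrt_nonneg _)
          (abs_nonneg _)
    _ = _ := by rw [Real.sqrt_mul zero_le_two, Real.sqrt_sq h0, mul_assoc]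

end Cotype

/-! ### Hölder duality and Hardy–Littlewood interpolation -/

section Inequalities

theorem rpow_expect_le {ι : Type*} [Fintype ι] [Nonempty ι] {f : ι → ℝ} (hf : ∀ i, 0 ≤ f i)
    {s : ℝ} (hs : 1 ≤ s) : (𝔼 i, f i) ^ s ≤ 𝔼 i, f i ^ s := by
  have hc : (Fintype.card ι : ℝ) ≠ 0 := by exact_mod_cast Fintype.card_ne_zero
  have h := Real.rpow_arith_mean_le_arith_mean_rpow Finset.univ
    (fun _ : ι => (Fintype.card ι : ℝ)⁻¹) f (fun _ _ => by positivity) (by simp [hc])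
    (fun i _ => hf i) hs
  simpa only [Fintype.expect_eq_sum_div_card, div_eq_inv_mul, Finset.mul_sum] using h

/-- Minkowski's inequality for averages. -/
theorem Lp_expect_le {ι κ : Type*} [Fintype ι] [Fintype κ] {g : ι → κ → ℝ}
    (hg : ∀ i j, 0 ≤ g i j) {q : ℝ} (hq : 1 ≤ q) :
    (∑ j, (𝔼 i, g i j) ^ q) ^ (1 / q) ≤ 𝔼 i, (∑ j, g i j ^ q) ^ (1 / q) := by
  have hq0 : 0 < q := by linarith
  have : Fact (1 ≤ ENNReal.ofReal q) := ⟨by simpa using ENNReal.ofReal_le_ofReal hq⟩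
  have hto : (ENNReal.ofReal q).toReal = q := ENNReal.toReal_ofReal hq0.le
  have hn : ∀ x : κ → ℝ, (∀ j, 0 ≤ x j) →
      ‖(WithLp.toLp (ENNReal.ofReal q) x : PiLp (ENNReal.ofReal q) fun _ : κ => ℝ)‖ =
        (∑ j, x j ^ q) ^ (1 / q) := fun x hx => by
    rw [PiLp.norm_eq_sum (by rw [hto]; exact hq0), hto]
    simp only [Real.norm_eq_abs, abs_of_nonneg (hx _)]
  have h := norm_sum_le Finset.univ fun i =>
    (WithLp.toLp (ENNReal.ofReal q) (g i) : PiLp (ENNReal.ofReal q) fun _ : κ => ℝ)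
  simp only [hn _ (hg _)] at h
  rw [← WithLp.toLp_sum, hn _ (fun j => by
    rw [Finset.sum_apply]; exact Finset.sum_nonneg fun i _ => hg i j)] at h
  simp only [Finset.sum_apply] at h
  simp only [Fintype.expect_eq_sum_div_card]
  have hc : (0 : ℝ) ≤ Fintype.card ι := Nat.cast_nonneg _
  simp only [Real.div_rpow (Finset.sum_nonneg fun i _ => hg i _) hc]
  rw [← Finset.sum_div, Real.div_rpow (Finset.sum_nonneg fun j _ =>
    Real.rpow_nonneg (Finset.sum_nonneg fun i _ => hg i _) _) (Real.rpow_nonneg hc _),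
    ← Real.rpow_mul hc, mul_one_div_cancel hq0.ne', Real.rpow_one]
  exact div_le_div_of_nonneg_right h hc

theorem sum_rpow_le_rpow_sum {ι : Type*} [Fintype ι] {u : ι → ℝ} (hu : ∀ k, 0 ≤ u k) {s t : ℝ}
    (hs : 0 < s) (hst : s ≤ t) : (∑ k, u k ^ t) ^ (1 / t) ≤ (∑ k, u k ^ s) ^ (1 / s) := by
  have ht : 0 < t := hs.trans_le hst
  set T := ∑ k, u k ^ s with hT
  have hT0 : 0 ≤ T := Finset.sum_nonneg fun k _ => Real.rpow_nonneg (hu k) _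
  have hle : ∑ k, u k ^ t ≤ T ^ (t / s) := by
    have hx : 0 ≤ t / s - 1 := by rw [sub_nonneg, one_le_div hs]; exact hst
    have hpow : ∀ x : ℝ, 0 ≤ x → x ^ (t / s) = x * x ^ (t / s - 1) := fun x h => by
      rw [mul_comm, ← Real.rpow_add_one' h (by rw [sub_add_cancel]; positivity), sub_add_cancel]
    rw [hpow T hT0, hT, Finset.sum_mul]
    refine Finset.sum_le_sum fun k _ => ?_
    have h0 := Real.rpow_nonneg (hu k) s
    have h1 : u k ^ t = (u k ^ s) ^ (t / s) := by
      rw [← Real.rpow_mul (hu k), mul_div_cancel₀ _ hs.ne']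
    rw [h1, hpow _ h0]
    refine mul_le_mul_of_nonneg_left (Real.rpow_le_rpow h0 ?_ hx) h0
    exact Finset.single_le_sum (f := fun k => u k ^ s)
      (fun k _ => Real.rpow_nonneg (hu k) _) (Finset.mem_univ k)
  calc (∑ k, u k ^ t) ^ (1 / t) ≤ (T ^ (t / s)) ^ (1 / t) :=
        Real.rpow_le_rpow (Finset.sum_nonneg fun k _ => Real.rpow_nonneg (hu k) _) hle
          (by positivity)
    _ = T ^ (1 / s) := by
        rw [← Real.rpow_mul hT0]
        congr 1
        field_simp

theorem sum_rpow_mul_rpow_le {ι : Type*} [Fintype ι] {x y : ι → ℝ} (hx : ∀ i, 0 ≤ x i)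
    (hy : ∀ i, 0 ≤ y i) {a b : ℝ} (ha : 0 ≤ a) (hb : 0 ≤ b) (hab : a + b = 1) :
    ∑ i, x i ^ a * y i ^ b ≤ (∑ i, x i) ^ a * (∑ i, y i) ^ b := by
  rcases ha.eq_or_lt with rfl | ha
  · obtain rfl : b = 1 := by linarith
    simp
  rcases hb.eq_or_lt with rfl | hb
  · obtain rfl : a = 1 := by linarith
    simp
  have h := Real.inner_le_Lp_mul_Lq_of_nonneg Finset.univ (f := fun i => x i ^ a)
    (g := fun i => y i ^ b) (p := 1 / a) (q := 1 / b)
    (by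
      rw [Real.holderConjugate_iff]
      refine ⟨?_, by simpa using hab⟩
      rw [lt_one_div one_pos ha, one_div_one]
      linarith)
    (fun i _ => Real.rpow_nonneg (hx i) _) (fun i _ => Real.rpow_nonneg (hy i) _)
  simpa only [← Real.rpow_mul (hx _), ← Real.rpow_mul (hy _), mul_one_div_cancel ha.ne',
    mul_one_div_cancel hb.ne', Real.rpow_one, one_div_one_div] using h

/-- The nonnegative part of the unit ball of `ℓ_p`, in terms of `P = 1 / p`. -/
def LpBall (P : ℝ) {n : ℕ} (μ : Fin n → ℝ) : Prop :=
  (∀ i, 0 ≤ μ i) ∧ (∀ i, μ i ≤ 1) ∧ (P ≠ 0 → ∑ i, μ i ^ (1 / P) ≤ 1)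

theorem lpBall_zero_one {n : ℕ} : LpBall 0 (fun _ : Fin n => 1) :=
  ⟨fun _ => zero_le_one, fun _ => le_rfl, fun h => (h rfl).elim⟩

theorem LpBall.mul {P : ℝ} (hP : 0 ≤ P) {n : ℕ} {μ ν : Fin n → ℝ} (hμ : LpBall P μ)
    (hν : LpBall 0 ν) : LpBall P fun i => μ i * ν i :=
  ⟨fun i => mul_nonneg (hμ.1 i) (hν.1 i), fun i => mul_le_one₀ (hμ.2.1 i) (hν.1 i) (hν.2.1 i),
    fun h => (Finset.sum_le_sum fun i _ => Real.rpow_le_rpow (mul_nonneg (hμ.1 i) (hν.1 i))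
      (mul_le_of_le_one_right (hμ.1 i) (hν.2.1 i)) (by positivity)).trans (hμ.2.2 h)⟩

/-- The converse of Hölder's inequality. -/
theorem sum_rpow_le_of_forall_lpBall {n : ℕ} {P s u M : ℝ} (hP : 0 ≤ P) (hs : 0 < s) (hu : 0 < u)
    (h : 1 / u = 1 / s - P) (hM : 0 ≤ M) {X : Fin n → ℝ} (hX : ∀ i, 0 ≤ X i)
    (hyp : ∀ μ : Fin n → ℝ, LpBall P μ → ∑ i, μ i ^ s * X i ≤ M ^ s) :
    ∑ i, X i ^ (u / s) ≤ M ^ u := by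
  have hexp : u * P + 1 = u / s := by
    have : u * (1 / u) = u * (1 / s - P) := by rw [h]
    rw [mul_one_div_cancel hu.ne'] at this
    rw [div_eq_mul_one_div]
    linarith
  rcases hP.eq_or_lt with rfl | hP
  · have hus : u / s = 1 := by linarith
    have hus' : u = s := by rwa [div_eq_one_iff_eq hs.ne'] at hus
    simpa [hus'.symm, hs.ne', hu.ne'] using hyp _ lpBall_zero_one
  set U := ∑ i, X i ^ (u / s) with hU
  have hU0 : 0 ≤ U := Finset.sum_nonneg fun i _ => Real.rpow_nonneg (hX i) _
  rcases hU0.eq_or_lt with hU0 | hU0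
  · rw [← hU0]; exact Real.rpow_nonneg hM _
  have hw : ∀ i, 0 ≤ X i ^ (u / s) / U := fun i =>
    div_nonneg (Real.rpow_nonneg (hX i) _) hU0.le
  have hw1 : ∑ i, X i ^ (u / s) / U = 1 := by rw [← Finset.sum_div, div_self hU0.ne']
  -- The extremal multiplier: the weights X_i^(u/s) / U sum to one, so their P-th powers have ℓ_p
  -- norm one, P = 1/p.
  have hb := hyp (fun i => (X i ^ (u / s) / U) ^ P)
    ⟨fun i => Real.rpow_nonneg (hw i) _, fun i => Real.rpow_le_one (hw i)
      (hw1 ▸ Finset.single_le_sum (f := fun i => X i ^ (u / s) / U) (fun i _ => hw i)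
        (Finset.mem_univ i)) hP.le,
      fun _ => by
        simp only [← Real.rpow_mul (hw _), mul_one_div_cancel hP.ne', Real.rpow_one]
        exact hw1.le⟩
  have hterm : ∀ i, ((X i ^ (u / s) / U) ^ P) ^ s * X i = X i ^ (u / s) / U ^ (P * s) := by
    intro i
    rw [← Real.rpow_mul (hw i), Real.div_rpow (Real.rpow_nonneg (hX i) _) hU0.le,
      ← Real.rpow_mul (hX i), div_mul_eq_mul_div]
    have e : u / s * (P * s) = u * P := by field_simp
    rw [e, ← Real.rpow_add_one' (hX i) (by positivity), hexp]
  simp only [hterm] at hb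
  have hs' : s / u = 1 - P * s := by
    have : s * (1 / u) = s * (1 / s - P) := by rw [h]
    rw [mul_sub, mul_one_div_cancel hs.ne'] at this
    rw [div_eq_mul_one_div]
    linarith
  rw [← Finset.sum_div, ← hU] at hb
  have hb' : U ^ (s / u) ≤ M ^ s := by rwa [hs', Real.rpow_sub hU0, Real.rpow_one]
  calc U = (U ^ (s / u)) ^ (u / s) := by
        rw [← Real.rpow_mul hU0.le, div_mul_div_cancel₀ hu.ne', div_self hs.ne', Real.rpow_one]
    _ ≤ (M ^ s) ^ (u / s) := Real.rpow_le_rpow (by positivity) hb' (by positivity)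
    _ = M ^ u := by rw [← Real.rpow_mul hM, mul_div_cancel₀ _ hs.ne']

/-- The Hardy–Littlewood interpolation argument for a nonnegative matrix. -/
theorem sum_rpow_rows_le {n : ℕ} {P r t q D : ℝ} (hP : 0 ≤ P) (hr : 0 < r) (ht : 0 < t)
    (htq : t ≤ q) (h : 1 / t = 1 / r - P) (hD : 0 ≤ D) {β : Fin n → Fin n → ℝ}
    (hβ : ∀ i j, 0 ≤ β i j)
    (hrow : ∀ μ : Fin n → ℝ, LpBall P μ → ∑ i, (∑ j, μ j ^ q * β i j) ^ (r / q) ≤ D ^ r)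
    (hcol : ∑ j, (∑ i, β i j) ^ (t / q) ≤ D ^ t) :
    ∑ i, (∑ j, β i j) ^ (t / q) ≤ D ^ t := by
  have hq : 0 < q := ht.trans_le htq
  have hrt : r ≤ t := by
    rw [← one_div_le_one_div ht hr]; linarith
  rcases hrt.eq_or_lt with rfl | hrt
  · have hP0 : P = 0 := by linarith
    subst hP0
    simpa using hrow _ lpBall_zero_one
  have hrq : r < q := hrt.trans_le htq
  set T : Fin n → ℝ := fun i => ∑ j, β i j with hT
  have hT0 : ∀ i, 0 ≤ T i := fun i => Finset.sum_nonneg fun j _ => hβ i j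
  -- The sum of T^(t/q) is split as β T^(t/q-1) and interpolated between `X` (weight T^(r/q-1)) and
  -- `Y` (weight one).
  set X : Fin n → ℝ := fun j => ∑ i, β i j * T i ^ (r / q - 1) with hX
  set Y : Fin n → ℝ := fun j => ∑ i, β i j with hY
  have hX0 : ∀ j, 0 ≤ X j := fun j => Finset.sum_nonneg fun i _ =>
    mul_nonneg (hβ i j) (Real.rpow_nonneg (hT0 i) _)
  have hY0 : ∀ j, 0 ≤ Y j := fun j => Finset.sum_nonneg fun i _ => hβ i j
  have hrq1 : 0 ≤ 1 - r / q := by rw [sub_nonneg, div_le_one hq]; exact hrq.le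
  -- By duality it suffices to test against μ^r; Hölder within each row cancels the power of T and
  -- leaves the row hypothesis.
  have hXb : ∑ j, X j ^ (t / r) ≤ D ^ t := by
    refine sum_rpow_le_of_forall_lpBall hP hr ht h hD hX0 fun μ hμ => le_trans ?_ (hrow μ hμ)
    simp only [hX, Finset.mul_sum]
    rw [Finset.sum_comm]
    refine Finset.sum_le_sum fun i _ => ?_
    have hN : 0 ≤ ∑ j, μ j ^ q * β i j :=
      Finset.sum_nonneg fun j _ => mul_nonneg (Real.rpow_nonneg (hμ.1 j) _) (hβ i j)
    have hH : ∑ j, μ j ^ r * β i j ≤ (∑ j, μ j ^ q * β i j) ^ (r / q) * T i ^ (1 - r / q) := by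
      refine le_trans (le_of_eq ?_) (sum_rpow_mul_rpow_le
        (fun j => mul_nonneg (Real.rpow_nonneg (hμ.1 j) q) (hβ i j)) (hβ i)
        (a := r / q) (b := 1 - r / q) (by positivity) hrq1 (by ring))
      refine Finset.sum_congr rfl fun j _ => ?_
      rw [Real.mul_rpow (Real.rpow_nonneg (hμ.1 j) _) (hβ i j), ← Real.rpow_mul (hμ.1 j),
        mul_div_cancel₀ _ hq.ne', mul_assoc, ← Real.rpow_add' (hβ i j) (by norm_num)]
      norm_num
    -- Only an inequality: the product is 0 when the row vanishes.
    have hTT : T i ^ (1 - r / q) * T i ^ (r / q - 1) ≤ 1 := by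
      rcases (hT0 i).eq_or_lt with h0 | h0
      · have : 1 - r / q ≠ 0 := by
          rw [sub_ne_zero]; exact ((div_lt_one hq).2 hrq).ne'
        rw [← h0, Real.zero_rpow this, zero_mul]
        exact zero_le_one
      · rw [← Real.rpow_add h0]; norm_num
    calc ∑ j, μ j ^ r * (β i j * T i ^ (r / q - 1))
        = (∑ j, μ j ^ r * β i j) * T i ^ (r / q - 1) := by
          rw [Finset.sum_mul]; exact Finset.sum_congr rfl fun j _ => by ring
      _ ≤ ((∑ j, μ j ^ q * β i j) ^ (r / q) * T i ^ (1 - r / q)) * T i ^ (r / q - 1) :=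
          mul_le_mul_of_nonneg_right hH (Real.rpow_nonneg (hT0 i) _)
      _ ≤ (∑ j, μ j ^ q * β i j) ^ (r / q) := by
          rw [mul_assoc]
          exact mul_le_of_le_one_right (Real.rpow_nonneg hN _) hTT
  -- Solves θ r + (1 - θ) q = t, which matches the powers of T and makes the outer Hölder exponents
  -- sum to one.
  set θ := (q - t) / (q - r) with hθ
  have hqr : 0 < q - r := by linarith
  have hθ0 : 0 ≤ θ := div_nonneg (by linarith) hqr.le
  have hθ1 : 0 ≤ 1 - θ := by
    rw [sub_nonneg, hθ, div_le_one hqr]; linarith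
  have hθr : θ * (r / q - 1) = t / q - 1 := by
    rw [hθ]; field_simp; ring
  have hθt : θ * r / t + (1 - θ) * q / t = 1 := by
    rw [hθ]; field_simp; ring
  have hTpow : ∀ i, T i ^ (t / q) = ∑ j, β i j * T i ^ (t / q - 1) := fun i => by
    rw [← Finset.sum_mul, mul_comm, ← Real.rpow_add_one' (hT0 i) (by rw [sub_add_cancel]; positivity),
      sub_add_cancel]
  change ∑ i, T i ^ (t / q) ≤ D ^ t
  simp only [hTpow]
  rw [Finset.sum_comm]
  have hXY : ∀ j, ∑ i, β i j * T i ^ (t / q - 1) ≤ X j ^ θ * Y j ^ (1 - θ) := fun j => by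
    refine le_trans (le_of_eq ?_) (sum_rpow_mul_rpow_le
      (fun i => mul_nonneg (hβ i j) (Real.rpow_nonneg (hT0 i) (r / q - 1))) (fun i => hβ i j)
      hθ0 hθ1 (by ring))
    refine Finset.sum_congr rfl fun i _ => ?_
    rw [Real.mul_rpow (hβ i j) (Real.rpow_nonneg (hT0 i) _), ← Real.rpow_mul (hT0 i),
      mul_comm (r / q - 1), hθr, mul_right_comm, ← Real.rpow_add' (hβ i j) (by norm_num)]
    norm_num
  have hDt : 0 ≤ D ^ t := Real.rpow_nonneg hD _
  have hea : 0 ≤ θ * r / t := by positivity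
  have heb : 0 ≤ (1 - θ) * q / t := by positivity
  calc ∑ j, ∑ i, β i j * T i ^ (t / q - 1) ≤ ∑ j, X j ^ θ * Y j ^ (1 - θ) :=
        Finset.sum_le_sum fun j _ => hXY j
    _ = ∑ j, (X j ^ (t / r)) ^ (θ * r / t) * (Y j ^ (t / q)) ^ ((1 - θ) * q / t) := by
        refine Finset.sum_congr rfl fun j _ => ?_
        rw [← Real.rpow_mul (hX0 j), ← Real.rpow_mul (hY0 j)]
        congr 2 <;> field_simp
    _ ≤ (∑ j, X j ^ (t / r)) ^ (θ * r / t) * (∑ j, Y j ^ (t / q)) ^ ((1 - θ) * q / t) :=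
        sum_rpow_mul_rpow_le (fun j => Real.rpow_nonneg (hX0 j) _)
          (fun j => Real.rpow_nonneg (hY0 j) _) hea heb hθt
    _ ≤ (D ^ t) ^ (θ * r / t) * (D ^ t) ^ ((1 - θ) * q / t) := by
        refine mul_le_mul (Real.rpow_le_rpow ?_ hXb hea) (Real.rpow_le_rpow ?_ hcol heb)
          (Real.rpow_nonneg ?_ _) (Real.rpow_nonneg hDt _)
        · exact Finset.sum_nonneg fun j _ => Real.rpow_nonneg (hX0 j) _
        · exact Finset.sum_nonneg fun j _ => Real.rpow_nonneg (hY0 j) _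
        · exact Finset.sum_nonneg fun j _ => Real.rpow_nonneg (hY0 j) _
    _ = D ^ t := by
        rw [← Real.rpow_add' hDt (by rw [hθt]; norm_num), hθt, Real.rpow_one]

end Inequalities

/-! ### Signed and weighted coefficient families -/

section MultiIndex

variable {F : Type*} [NormedAddCommGroup F] [NormedSpace ℝ F]

/-- Cotype is iterated index by index; Minkowski moves the ℓ_q sum inside the average over the
earlier signs. -/
theorem CotypeOne.multiIndex {q C : ℝ} (hC : 0 ≤ C) (hq : 1 ≤ q) (hF : CotypeOne q C F) {n : ℕ} :
    ∀ {m : ℕ} (a : (Fin m → Fin n) → F), (∑ J, ‖a J‖ ^ q) ^ (1 / q) ≤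
      C ^ m * 𝔼 ε : Fin m → Fin n → ℤˣ, ‖∑ J, (∏ l, ((ε l (J l) : ℤ) : ℝ)) • a J‖ := by
  have hq0 : 0 < q := by linarith
  intro m
  induction m with
  | zero =>
    intro a
    have h : ∀ ε : Fin 0 → Fin n → ℤˣ,
        ‖∑ J, (∏ l, ((ε l (J l) : ℤ) : ℝ)) • a J‖ = ‖a default‖ := fun ε => by simp
    simp only [h, Fintype.expect_const]
    rw [Fintype.sum_unique, ← Real.rpow_mul (norm_nonneg _), mul_one_div_cancel hq0.ne']
    simp
  | succ m ih =>
    intro a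
    set G : (Fin m → Fin n → ℤˣ) → Fin n → F := fun ε i =>
      ∑ J, (∏ l, ((ε l (J l) : ℤ) : ℝ)) • a (Fin.cons i J) with hG
    have hsum : ∀ i, ∑ J, ‖a (Fin.cons i J)‖ ^ q ≤ (C ^ m * 𝔼 ε, ‖G ε i‖) ^ q := fun i => by
      have h0 : 0 ≤ ∑ J : Fin m → Fin n, ‖a (Fin.cons i J)‖ ^ q :=
        Finset.sum_nonneg fun J _ => Real.rpow_nonneg (norm_nonneg _) _
      have h1 := Real.rpow_le_rpow (Real.rpow_nonneg h0 _)
        (ih fun J => a (Fin.cons i J)) hq0.le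
      rwa [← Real.rpow_mul h0, one_div_mul_cancel hq0.ne', Real.rpow_one] at h1
    have hE : ∀ i, 0 ≤ 𝔼 ε, ‖G ε i‖ := fun i => Finset.expect_nonneg fun _ _ => norm_nonneg _
    have hCm : 0 ≤ C ^ m := pow_nonneg hC m
    calc (∑ J, ‖a J‖ ^ q) ^ (1 / q)
        ≤ (∑ i, (C ^ m * 𝔼 ε, ‖G ε i‖) ^ q) ^ (1 / q) := by
          rw [sum_fin_cons]
          exact Real.rpow_le_rpow (Finset.sum_nonneg fun i _ => Finset.sum_nonneg fun J _ =>
            Real.rpow_nonneg (norm_nonneg _) _) (Finset.sum_le_sum fun i _ => hsum i)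
            (by positivity)
      _ = C ^ m * (∑ i, (𝔼 ε, ‖G ε i‖) ^ q) ^ (1 / q) := by
          simp only [Real.mul_rpow hCm (hE _)]
          rw [← Finset.mul_sum, Real.mul_rpow (Real.rpow_nonneg hCm _)
            (Finset.sum_nonneg fun i _ => Real.rpow_nonneg (hE i) _), ← Real.rpow_mul hCm,
            mul_one_div_cancel hq0.ne', Real.rpow_one]
      _ ≤ C ^ m * 𝔼 ε, (∑ i, ‖G ε i‖ ^ q) ^ (1 / q) :=
          mul_le_mul_of_nonneg_left (Lp_expect_le (fun ε i => norm_nonneg (G ε i)) hq) hCm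
      _ ≤ C ^ m * 𝔼 ε, (C * 𝔼 δ, ‖signSum δ (G ε)‖) :=
          mul_le_mul_of_nonneg_left (Finset.expect_le_expect fun ε _ => hF n (G ε)) hCm
      _ = _ := by
          rw [← Finset.mul_expect, expect_fin_cons, Finset.expect_comm, pow_succ, mul_assoc]
          congr 3
          funext δ
          refine Finset.expect_congr rfl fun ε _ => ?_
          congr 1
          rw [sum_fin_cons]
          simp only [signSum, hG, Finset.smul_sum, smul_smul, Fin.prod_univ_succ, Fin.cons_zero,
            Fin.cons_succ]

/-- The coefficients `a` of a multilinear map with values in `F` satisfy the estimate that an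
absolutely `(r, 1)`-summing operator yields in each coordinate separately, for all nonnegative
multipliers in the unit balls of `ℓ_p`, where `P l = 1 / p l`, and all signs. -/
def SignSummable (r : ℝ) {m n : ℕ} (P : Fin m → ℝ) (M : ℝ) (a : (Fin m → Fin n) → F) : Prop :=
  ∀ μ : Fin m → Fin n → ℝ, (∀ l, LpBall (P l) (μ l)) → ∀ (ε : Fin m → Fin n → ℤˣ) (k : Fin m),
    ∑ i, ‖∑ J with J k = i, (∏ l, ((ε l (J l) : ℤ) : ℝ) * μ l (J l)) • a J‖ ^ r ≤ M ^ r

/-- A weight frozen into the coefficients uses up the ℓ_p multiplier at `l`; an ℓ_∞ multiplier,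
exponent 0, remains free. -/
theorem SignSummable.smul {r M : ℝ} {m n : ℕ} {P : Fin m → ℝ} {a : (Fin m → Fin n) → F}
    (h : SignSummable r P M a) {l : Fin m} (hP : 0 ≤ P l) {μ : Fin n → ℝ} (hμ : LpBall (P l) μ) :
    SignSummable r (Function.update P l 0) M fun J => μ (J l) • a J := by
  intro ν hν ε k
  have hball : ∀ i, LpBall (P i) (Function.update ν l (fun j => μ j * ν l j) i) := fun i => by
    by_cases hi : i = l
    · subst hi
      rw [Function.update_self]
      have := hν i
      rw [Function.update_self] at this
      exact hμ.mul hP this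
    · rw [Function.update_of_ne hi]
      have := hν i
      rwa [Function.update_of_ne hi] at this
  refine le_trans (le_of_eq ?_) (h _ hball ε k)
  refine Finset.sum_congr rfl fun i _ => ?_
  congr 2
  refine Finset.sum_congr rfl fun J _ => ?_
  have hprod : ∏ i, ((ε i (J i) : ℤ) : ℝ) * Function.update ν l (fun j => μ j * ν l j) i (J i) =
      (∏ i, ((ε i (J i) : ℤ) : ℝ) * ν i (J i)) * μ (J l) := by
    rw [← Fintype.prod_ite_eq' l fun _ => μ (J l), ← Finset.prod_mul_distrib]
    refine Finset.prod_congr rfl fun i _ => ?_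
    by_cases hi : i = l
    · subst hi
      rw [Function.update_self, if_pos rfl]
      ring
    · rw [Function.update_of_ne hi, if_neg hi, mul_one]
  rw [hprod, smul_smul]

/-- Cotype bounds each row by an average over signs; Jensen with r ≥ 1 lets the rows be summed for
each fixed choice of signs. -/
theorem SignSummable.sum_rows_le_of_zero {r q C M : ℝ} (hr : 1 ≤ r) (hq : 1 ≤ q) (hC : 0 ≤ C)
    (hM : 0 ≤ M) (hF : CotypeOne q C F) {m n : ℕ} {a : (Fin m → Fin n) → F}
    (h : SignSummable r (fun _ => 0) M a) (k : Fin m) :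
    ∑ i, (∑ J with J k = i, ‖a J‖ ^ q) ^ (r / q) ≤ (C ^ m * M) ^ r := by
  have hq0 : 0 < q := by linarith
  have hr0 : 0 < r := by linarith
  have hCm : 0 ≤ C ^ m := pow_nonneg hC m
  set G : (Fin m → Fin n → ℤˣ) → Fin n → F := fun ε i =>
    ∑ J with J k = i, (∏ l, ((ε l (J l) : ℤ) : ℝ)) • a J with hG
  have hrow : ∀ i, (∑ J with J k = i, ‖a J‖ ^ q) ^ (r / q) ≤ (C ^ m) ^ r * 𝔼 ε, ‖G ε i‖ ^ r := by
    intro i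
    have h0 : 0 ≤ ∑ J with J k = i, ‖a J‖ ^ q :=
      Finset.sum_nonneg fun J _ => Real.rpow_nonneg (norm_nonneg _) _
    have h1 := hF.multiIndex hC hq fun J => if J k = i then a J else 0
    have h2 : ∑ J, ‖if J k = i then a J else 0‖ ^ q = ∑ J with J k = i, ‖a J‖ ^ q := by
      rw [Finset.sum_filter]
      refine Finset.sum_congr rfl fun J _ => ?_
      split_ifs
      · rfl
      · rw [norm_zero, Real.zero_rpow hq0.ne']
    have h3 : ∀ ε : Fin m → Fin n → ℤˣ,
        ∑ J, (∏ l, ((ε l (J l) : ℤ) : ℝ)) • (if J k = i then a J else 0) = G ε i := fun ε => by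
      simp only [hG]
      rw [Finset.sum_filter]
      refine Finset.sum_congr rfl fun J _ => ?_
      rw [smul_ite, smul_zero]
    rw [h2] at h1
    simp only [h3] at h1
    have hE : 0 ≤ 𝔼 ε, ‖G ε i‖ := Finset.expect_nonneg fun _ _ => norm_nonneg _
    calc (∑ J with J k = i, ‖a J‖ ^ q) ^ (r / q)
        = ((∑ J with J k = i, ‖a J‖ ^ q) ^ (1 / q)) ^ r := by
          rw [← Real.rpow_mul h0, one_div_mul_eq_div]
      _ ≤ (C ^ m * 𝔼 ε, ‖G ε i‖) ^ r := Real.rpow_le_rpow (Real.rpow_nonneg h0 _) h1 hr0.le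
      _ = (C ^ m) ^ r * (𝔼 ε, ‖G ε i‖) ^ r := Real.mul_rpow hCm hE
      _ ≤ _ := mul_le_mul_of_nonneg_left (rpow_expect_le (fun _ => norm_nonneg _) hr)
          (Real.rpow_nonneg hCm _)
  calc ∑ i, (∑ J with J k = i, ‖a J‖ ^ q) ^ (r / q)
      ≤ ∑ i, (C ^ m) ^ r * 𝔼 ε, ‖G ε i‖ ^ r := Finset.sum_le_sum fun i _ => hrow i
    _ = (C ^ m) ^ r * 𝔼 ε, ∑ i, ‖G ε i‖ ^ r := by rw [← Finset.mul_sum, Finset.expect_sum_comm]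
    _ ≤ (C ^ m) ^ r * M ^ r := by
        refine mul_le_mul_of_nonneg_left (Finset.expect_le Finset.univ_nonempty fun ε _ => ?_)
          (Real.rpow_nonneg hCm _)
        have := h (fun _ _ => 1) (fun _ => lpBall_zero_one) ε k
        simpa only [mul_one] using this
    _ = (C ^ m * M) ^ r := (Real.mul_rpow hCm hM).symm

/-- `S` collects the coordinates whose weights are still available; each one raises the outer
exponent by duality, simultaneously for all choices of outer coordinate. -/
theorem SignSummable.sum_rows_le {r q C M : ℝ} (hr : 1 ≤ r) (hq : 1 ≤ q) (hC : 0 ≤ C)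
    (hM : 0 ≤ M) (hF : CotypeOne q C F) {m n : ℕ} {P : Fin m → ℝ} (hP : ∀ l, 0 ≤ P l)
    (S : Finset (Fin m)) :
    ∀ {t : ℝ}, 0 < t → t ≤ q → 1 / t = 1 / r - ∑ l ∈ S, P l → ∀ {a : (Fin m → Fin n) → F},
      SignSummable r (fun l => if l ∈ S then P l else 0) M a → ∀ k : Fin m,
        ∑ i, (∑ J with J k = i, ‖a J‖ ^ q) ^ (t / q) ≤ (C ^ m * M) ^ t := by
  have hq0 : 0 < q := by linarith
  have hD : 0 ≤ C ^ m * M := mul_nonneg (pow_nonneg hC m) hM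
  induction S using Finset.induction_on with
  | empty =>
    intro t ht _ h a ha k
    obtain rfl : t = r := by simpa using h
    exact SignSummable.sum_rows_le_of_zero hr hq hC hM hF (by simpa using ha) k
  | insert l S hl ih =>
    intro t ht htq h a ha k
    rw [Finset.sum_insert hl] at h
    set u : ℝ := (1 / t + P l)⁻¹ with hu
    have hup : 0 < 1 / t + P l := add_pos_of_pos_of_nonneg (by positivity) (hP l)
    have hu0 : 0 < u := inv_pos.2 hup
    have hu1 : 1 / u = 1 / t + P l := by rw [hu, one_div, inv_inv]
    have htu : 1 / t = 1 / u - P l := by rw [hu1]; ring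
    have hut : u ≤ t := by
      rw [← one_div_le_one_div ht hu0, hu1]; linarith [hP l]
    have hstep : ∀ μ : Fin n → ℝ, LpBall (P l) μ → ∀ k : Fin m,
        ∑ i, (∑ J with J k = i, μ (J l) ^ q * ‖a J‖ ^ q) ^ (u / q) ≤ (C ^ m * M) ^ u := by
      intro μ hμ k
      have h1 := ha.smul (l := l) (by simpa using hP l) (by simpa using hμ)
      have h2 : Function.update (fun i => if i ∈ insert l S then P i else 0) l 0 =
          fun i => if i ∈ S then P i else 0 := by
        funext i
        by_cases hi : i = l
        · subst hi; simp [hl]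
        · simp [hi]
      rw [h2] at h1
      have h3 := ih hu0 (hut.trans htq) (by rw [hu1, h]; ring) h1 k
      simpa only [norm_smul, Real.norm_eq_abs, abs_of_nonneg (hμ.1 _),
        Real.mul_rpow (hμ.1 _) (norm_nonneg _)] using h3
    have hW : ∀ k i, 0 ≤ ∑ J : Fin m → Fin n with J k = i, ‖a J‖ ^ q := fun k i =>
      Finset.sum_nonneg fun J _ => Real.rpow_nonneg (norm_nonneg _) _
    -- When `l` is outermost the weight is constant on each slice, so the converse of Hölder applies
    -- directly.
    have hdiag : ∑ i, (∑ J with J l = i, ‖a J‖ ^ q) ^ (t / q) ≤ (C ^ m * M) ^ t := by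
      have h1 := sum_rpow_le_of_forall_lpBall (hP l) hu0 ht htu hD
        (X := fun i => (∑ J with J l = i, ‖a J‖ ^ q) ^ (u / q))
        (fun i => Real.rpow_nonneg (hW l i) _) fun μ hμ => by
          refine le_trans (le_of_eq (Finset.sum_congr rfl fun i _ => ?_)) (hstep μ hμ l)
          have h2 : ∑ J with J l = i, μ (J l) ^ q * ‖a J‖ ^ q =
              μ i ^ q * ∑ J with J l = i, ‖a J‖ ^ q := by
            rw [Finset.mul_sum]
            refine Finset.sum_congr rfl fun J hJ => ?_
            rw [(Finset.mem_filter.1 hJ).2]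
          rw [h2, Real.mul_rpow (Real.rpow_nonneg (hμ.1 i) _) (hW l i), ← Real.rpow_mul (hμ.1 i),
            mul_div_cancel₀ _ hq0.ne']
      refine le_trans (le_of_eq (Finset.sum_congr rfl fun i _ => ?_)) h1
      rw [← Real.rpow_mul (hW l i)]
      congr 1
      field_simp
    by_cases hk : k = l
    · subst hk
      exact hdiag
    -- For k ≠ l, rows are indexed by coordinate k and columns by l: `hstep` controls the weighted
    -- rows, `hdiag` the columns.
    set β : Fin n → Fin n → ℝ := fun i j =>
      ∑ J ∈ ({J | J k = i} : Finset (Fin m → Fin n)) with J l = j, ‖a J‖ ^ q with hβ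
    have hβrow : ∀ i, ∑ j, β i j = ∑ J with J k = i, ‖a J‖ ^ q := fun i =>
      Finset.sum_fiberwise _ _ _
    have hβcol : ∀ j, ∑ i, β i j = ∑ J with J l = j, ‖a J‖ ^ q := fun j => by
      rw [← Finset.sum_fiberwise (Finset.univ.filter fun J : Fin m → Fin n => J l = j)
        fun J => J k]
      refine Finset.sum_congr rfl fun i _ => ?_
      rw [Finset.filter_comm]
    have hβμ : ∀ (μ : Fin n → ℝ) i,
        ∑ j, μ j ^ q * β i j = ∑ J with J k = i, μ (J l) ^ q * ‖a J‖ ^ q := fun μ i => by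
      rw [← Finset.sum_fiberwise (Finset.univ.filter fun J : Fin m → Fin n => J k = i)
        fun J => J l]
      refine Finset.sum_congr rfl fun j _ => ?_
      simp only [hβ]
      rw [Finset.mul_sum]
      refine Finset.sum_congr rfl fun J hJ => ?_
      rw [(Finset.mem_filter.1 hJ).2]
    have hfin := sum_rpow_rows_le (hP l) hu0 ht htq htu hD (β := β)
      (fun i j => Finset.sum_nonneg fun J _ => Real.rpow_nonneg (norm_nonneg _) _)
      (fun μ hμ => by simpa only [hβμ] using hstep μ hμ k) (by simpa only [hβcol] using hdiag)
    simpa only [hβrow] using hfin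

theorem sum_filter_zero_eq {n m : ℕ} (f : (Fin (m + 1) → Fin n) → ℝ) (i : Fin n) :
    ∑ J with J 0 = i, f J = ∑ J, f (Fin.cons i J) := by
  rw [Finset.sum_filter, sum_fin_cons, Finset.sum_comm]
  refine Finset.sum_congr rfl fun J _ => ?_
  simp

/-- The last gain is taken with coordinate 0 outermost, where duality alone suffices; hence `s` need
not be at most `q`. -/
theorem SignSummable.sum_fst_le {r q C M : ℝ} (hr : 1 ≤ r) (hq : 1 ≤ q) (hC : 0 ≤ C)
    (hM : 0 ≤ M) (hF : CotypeOne q C F) {m n : ℕ} {P : Fin (m + 1) → ℝ} (hP : ∀ l, 0 ≤ P l)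
    {t s : ℝ} (ht : 0 < t) (htq : t ≤ q) (h : 1 / t = 1 / r - ∑ l : Fin m, P l.succ) (hs : 0 < s)
    (hst : 1 / s = 1 / t - P 0) {a : (Fin (m + 1) → Fin n) → F} (ha : SignSummable r P M a) :
    ∑ i, (∑ J, ‖a (Fin.cons i J)‖ ^ q) ^ (s / q) ≤ (C ^ (m + 1) * M) ^ s := by
  have hq0 : 0 < q := by linarith
  have hD : 0 ≤ C ^ (m + 1) * M := mul_nonneg (pow_nonneg hC _) hM
  have hW : ∀ i, 0 ≤ ∑ J : Fin m → Fin n, ‖a (Fin.cons i J)‖ ^ q := fun i =>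
    Finset.sum_nonneg fun J _ => Real.rpow_nonneg (norm_nonneg _) _
  have h1 := sum_rpow_le_of_forall_lpBall (hP 0) ht hs hst hD
    (X := fun i => (∑ J, ‖a (Fin.cons i J)‖ ^ q) ^ (t / q))
    (fun i => Real.rpow_nonneg (hW i) _) fun μ hμ => by
      have h2 := ha.smul (hP 0) hμ
      have h3 : Function.update P 0 0 =
          fun l => if l ∈ Finset.univ.erase (0 : Fin (m + 1)) then P l else 0 := by
        funext i
        by_cases hi : i = 0
        · subst hi; simp
        · simp [hi]
      rw [h3] at h2
      have h4 : ∑ l ∈ Finset.univ.erase (0 : Fin (m + 1)), P l = ∑ l : Fin m, P l.succ := by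
        have := Finset.add_sum_erase Finset.univ P (Finset.mem_univ 0)
        rw [Fin.sum_univ_succ] at this
        linarith
      have h5 := SignSummable.sum_rows_le hr hq hC hM hF hP (Finset.univ.erase 0) ht htq
        (by rw [h4, h]) h2 0
      refine le_trans (le_of_eq (Finset.sum_congr rfl fun i _ => ?_)) h5
      simp only [sum_filter_zero_eq, norm_smul, Real.norm_eq_abs, abs_of_nonneg (hμ.1 _),
        Real.mul_rpow (hμ.1 _) (norm_nonneg _), Fin.cons_zero]
      rw [← Finset.mul_sum, Real.mul_rpow (Real.rpow_nonneg (hμ.1 i) _) (hW i),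
        ← Real.rpow_mul (hμ.1 i), mul_div_cancel₀ _ hq0.ne']
  refine le_trans (le_of_eq (Finset.sum_congr rfl fun i _ => ?_)) h1
  rw [← Real.rpow_mul (hW i)]
  congr 1
  field_simp

end MultiIndex

/-! ### Cotype of mixed-norm spaces -/

section MixedNorm

theorem mixedNorm_nonneg {n : ℕ} : ∀ {m : ℕ} (s : Fin m → ℝ) {a : (Fin m → Fin n) → ℝ},
    (∀ J, 0 ≤ a J) → 0 ≤ mixedNorm m s a
  | 0, _, _, ha => ha _
  | _ + 1, s, _, ha => Real.rpow_nonneg (Finset.sum_nonneg fun _ _ =>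
      Real.rpow_nonneg (mixedNorm_nonneg (Fin.tail s) fun _ => ha _) _) _

theorem mixedNorm_const {n : ℕ} {q : ℝ} (hq : 0 < q) : ∀ {m : ℕ} {a : (Fin m → Fin n) → ℝ},
    (∀ J, 0 ≤ a J) → mixedNorm m (fun _ => q) a = (∑ J, a J ^ q) ^ (1 / q)
  | 0, a, ha => by
      rw [Fintype.sum_unique, ← Real.rpow_mul (ha _), mul_one_div_cancel hq.ne', Real.rpow_one]
      exact congrArg a (Subsingleton.elim _ _)
  | m + 1, a, ha => by
      rw [sum_fin_cons]
      change (∑ j, mixedNorm m (fun _ => q) (fun J => a (Fin.cons j J)) ^ q) ^ (1 / q) = _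
      congr 1
      refine Finset.sum_congr rfl fun j _ => ?_
      rw [mixedNorm_const hq fun J => ha _, ← Real.rpow_mul (Finset.sum_nonneg fun J _ =>
        Real.rpow_nonneg (ha _) _), one_div_mul_cancel hq.ne', Real.rpow_one]

theorem mixedNorm_succ_rpow {n m : ℕ} {s : Fin (m + 1) → ℝ} (hs : 0 < s 0)
    {a : (Fin (m + 1) → Fin n) → ℝ} (ha : ∀ J, 0 ≤ a J) :
    mixedNorm (m + 1) s a ^ s 0 =
      ∑ j, mixedNorm m (Fin.tail s) (fun J => a (Fin.cons j J)) ^ s 0 := by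
  rw [mixedNorm, ← Real.rpow_mul (Finset.sum_nonneg fun j _ =>
    Real.rpow_nonneg (mixedNorm_nonneg _ fun J => ha _) _), one_div_mul_cancel hs.ne',
    Real.rpow_one]

theorem mixedNorm_mul {n : ℕ} {c : ℝ} (hc : 0 ≤ c) : ∀ {m : ℕ} {s : Fin m → ℝ},
    (∀ i, 0 < s i) → ∀ {a : (Fin m → Fin n) → ℝ}, (∀ J, 0 ≤ a J) →
      mixedNorm m s (fun J => c * a J) = c * mixedNorm m s a
  | 0, _, _, _, _ => rfl
  | m + 1, s, hs, a, ha => by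
      have h0 : ∀ j, 0 ≤ mixedNorm m (Fin.tail s) (fun J => a (Fin.cons j J)) := fun j =>
        mixedNorm_nonneg _ fun J => ha _
      simp only [mixedNorm]
      simp only [mixedNorm_mul hc (s := Fin.tail s) (fun i => hs i.succ)
        (fun J => ha (Fin.cons _ J)), Real.mul_rpow hc (h0 _)]
      rw [← Finset.mul_sum, Real.mul_rpow (Real.rpow_nonneg hc _)
        (Finset.sum_nonneg fun j _ => Real.rpow_nonneg (h0 j) _), ← Real.rpow_mul hc,
        mul_one_div_cancel (hs 0).ne', Real.rpow_one]

/-- Cotype estimates pass to larger exponents: ℓ_t norms decrease in t on the left, Jensen acts on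
the right. -/
theorem sum_rpow_le_expect_of_le {ι κ : Type*} [Fintype ι] [Fintype κ] [Nonempty κ] {u : ι → ℝ}
    {g : κ → ℝ} (hu : ∀ i, 0 ≤ u i) (hg : ∀ i, 0 ≤ g i) {s t C : ℝ} (hs : 0 < s) (hst : s ≤ t)
    (hC : 0 ≤ C) (h : ∑ i, u i ^ s ≤ C ^ s * 𝔼 i, g i ^ s) :
    ∑ i, u i ^ t ≤ C ^ t * 𝔼 i, g i ^ t := by
  have ht : 0 < t := hs.trans_le hst
  have hS : ∀ x : ℝ, 0 ≤ ∑ i, u i ^ x := fun x =>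
    Finset.sum_nonneg fun i _ => Real.rpow_nonneg (hu i) _
  have hE : 0 ≤ 𝔼 i, g i ^ s := Finset.expect_nonneg fun i _ => Real.rpow_nonneg (hg i) _
  have hpow : ∀ x : ℝ, 0 ≤ x → (x ^ s) ^ (t / s) = x ^ t := fun x hx => by
    rw [← Real.rpow_mul hx, mul_div_cancel₀ _ hs.ne']
  calc ∑ i, u i ^ t = ((∑ i, u i ^ t) ^ (1 / t)) ^ t := by
        rw [← Real.rpow_mul (hS t), one_div_mul_cancel ht.ne', Real.rpow_one]
    _ ≤ ((∑ i, u i ^ s) ^ (1 / s)) ^ t := Real.rpow_le_rpow (Real.rpow_nonneg (hS t) _)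
        (sum_rpow_le_rpow_sum hu hs hst) ht.le
    _ = (∑ i, u i ^ s) ^ (t / s) := by rw [← Real.rpow_mul (hS s), one_div_mul_eq_div]
    _ ≤ (C ^ s * 𝔼 i, g i ^ s) ^ (t / s) := Real.rpow_le_rpow (hS s) h (by positivity)
    _ = C ^ t * (𝔼 i, g i ^ s) ^ (t / s) := by
        rw [Real.mul_rpow (Real.rpow_nonneg hC _) hE, hpow C hC]
    _ ≤ C ^ t * 𝔼 i, g i ^ t := by
        refine mul_le_mul_of_nonneg_left ?_ (Real.rpow_nonneg hC _)
        refine (rpow_expect_le (fun i => Real.rpow_nonneg (hg i) s)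
          ((one_le_div hs).2 hst)).trans (le_of_eq ?_)
        exact Finset.expect_congr rfl fun i _ => hpow _ (hg i)

variable {F : Type*} [NormedAddCommGroup F] [NormedSpace ℝ F]

/-- A mixed-norm space with decreasing exponents, all at least `q`, over a space of cotype `q`
has the cotype of its outermost exponent. -/
theorem CotypeOne.mixedNorm {q C : ℝ} (hC : 0 ≤ C) (hq : 1 ≤ q) (hF : CotypeOne q C F) {N n : ℕ} :
    ∀ {m : ℕ} {s : Fin m → ℝ}, Antitone s → (∀ i, q ≤ s i) → ∀ {t : ℝ}, q ≤ t → (∀ i, s i ≤ t) →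
      ∀ x : Fin N → (Fin m → Fin n) → F,
        ∑ k, _root_.mixedNorm m s (fun J => ‖x k J‖) ^ t ≤
          C ^ t * 𝔼 ε, _root_.mixedNorm m s (fun J => ‖signSum ε (fun k => x k J)‖) ^ t := by
  have hq0 : 0 < q := by linarith
  intro m
  induction m with
  | zero =>
    intro s _ _ t hqt _ x
    refine sum_rpow_le_expect_of_le (fun k => norm_nonneg _) (fun k => norm_nonneg _) hq0 hqt hC ?_
    have hE : 0 ≤ 𝔼 ε, ‖signSum ε fun k => x k Fin.elim0‖ :=
      Finset.expect_nonneg fun _ _ => norm_nonneg _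
    have h0 : 0 ≤ ∑ k, ‖x k Fin.elim0‖ ^ q :=
      Finset.sum_nonneg fun k _ => Real.rpow_nonneg (norm_nonneg _) _
    have h1 := Real.rpow_le_rpow (Real.rpow_nonneg h0 _) (hF N fun k => x k Fin.elim0) hq0.le
    rw [← Real.rpow_mul h0, one_div_mul_cancel hq0.ne', Real.rpow_one, Real.mul_rpow hC hE] at h1
    exact h1.trans (mul_le_mul_of_nonneg_left (rpow_expect_le (fun _ => norm_nonneg _) hq)
      (Real.rpow_nonneg hC _))
  | succ m ih =>
    intro s hs hqs t _ hst x
    have hs0 : 0 < s 0 := hq0.trans_le (hqs 0)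
    refine sum_rpow_le_expect_of_le (fun k => mixedNorm_nonneg _ fun _ => norm_nonneg _)
      (fun k => mixedNorm_nonneg _ fun _ => norm_nonneg _) hs0 (hst 0) hC ?_
    simp only [mixedNorm_succ_rpow hs0 fun J => norm_nonneg _]
    -- At the exponent `s 0` the outermost sum commutes with the sum over `k` and with the average,
    -- so each fibre is treated alone.
    rw [Finset.sum_comm, Finset.expect_sum_comm, Finset.mul_sum]
    refine Finset.sum_le_sum fun j _ => ?_
    exact ih (s := Fin.tail s) (fun i j hij => hs (Fin.succ_le_succ_iff.2 hij))
      (fun i => hqs _) (hqs 0) (fun i => hs (Fin.zero_le _)) fun k J => x k (Fin.cons j J)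

end MixedNorm

/-! ### Monotonicity of the exponents -/

section Exponents

theorem tailSum_zero {m : ℕ} (p : Fin (m + 1) → ℝ≥0∞) :
    tailSum p 0 = ∑ j, ((p j)⁻¹).toReal := by
  have : Finset.Ici (0 : Fin (m + 1)) = Finset.univ := by ext; simp
  rw [tailSum, this]

theorem tailSum_succ {m : ℕ} (p : Fin (m + 1) → ℝ≥0∞) (k : Fin m) :
    tailSum p k.succ = tailSum (Fin.tail p) k := by
  simp only [tailSum, ← Fin.map_succEmb_Ici, Finset.sum_map]
  rfl

theorem tailSum_antitone {m : ℕ} (p : Fin m → ℝ≥0∞) : Antitone (tailSum p) := fun _ _ h =>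
  Finset.sum_le_sum_of_subset_of_nonneg (Finset.Ici_subset_Ici.2 h) fun _ _ _ =>
    ENNReal.toReal_nonneg

theorem tailSum_le_sum {m : ℕ} (p : Fin m → ℝ≥0∞) (k : Fin m) :
    tailSum p k ≤ ∑ j, ((p j)⁻¹).toReal :=
  Finset.sum_le_sum_of_subset_of_nonneg (Finset.subset_univ _) fun _ _ _ => ENNReal.toReal_nonneg

theorem hlExponent_tail {m : ℕ} (p : Fin (m + 1) → ℝ≥0∞) (r q : ℝ) (k₀ : Fin m) :
    Fin.tail (hlExponent p r q k₀.succ) = hlExponent (Fin.tail p) r q k₀ := by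
  funext k
  simp only [Fin.tail, hlExponent, Fin.succ_le_succ_iff, tailSum_succ]

variable {m : ℕ} {p : Fin m → ℝ≥0∞} {r q : ℝ} {k₀ : Fin m}

theorem le_hlExponent (hq : 0 < q) (hupp : ∑ j, ((p j)⁻¹).toReal < 1 / r)
    (hk₀ : 1 / r - 1 / q ≤ tailSum p k₀) (k : Fin m) : q ≤ hlExponent p r q k₀ k := by
  unfold hlExponent
  split_ifs with h
  · have h1 := tailSum_antitone p h
    have h2 := tailSum_le_sum p k
    rw [le_inv_comm₀ hq (by linarith), ← one_div]
    linarith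
  · exact le_rfl

theorem hlExponent_antitone (hq : 0 < q) (hupp : ∑ j, ((p j)⁻¹).toReal < 1 / r)
    (hk₀ : 1 / r - 1 / q ≤ tailSum p k₀) : Antitone (hlExponent p r q k₀) := by
  intro i j hij
  by_cases hj : j ≤ k₀
  · have h1 := tailSum_antitone p hij
    have h2 := tailSum_le_sum p i
    simp only [hlExponent, if_pos hj, if_pos (hij.trans hj)]
    exact inv_anti₀ (by linarith) (by linarith)
  · have : hlExponent p r q k₀ j = q := if_neg hj
    rw [this]
    exact le_hlExponent hq hupp hk₀ i

end Exponents

/-! ### Induction on the number of coordinates -/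

section Main

variable {F : Type*} [NormedAddCommGroup F] [NormedSpace ℝ F]

theorem SignSummable.signSum {r M : ℝ} {m n : ℕ} {P : Fin (m + 1) → ℝ}
    {a : (Fin (m + 1) → Fin n) → F} (h : SignSummable r P M a) {μ : Fin n → ℝ}
    (hμ : LpBall (P 0) μ) (ε : Fin n → ℤˣ) :
    SignSummable r (Fin.tail P) M
      fun J => _root_.signSum ε fun j => μ j • a (Fin.cons j J) := by
  intro ν hν δ k
  have h1 := h (Fin.cons μ ν) (fun l => Fin.cases hμ hν l) (Fin.cons ε δ) k.succ
  refine le_trans (le_of_eq (Finset.sum_congr rfl fun i _ => ?_)) h1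
  congr 2
  rw [Finset.sum_filter, Finset.sum_filter, sum_fin_cons, Finset.sum_comm]
  refine Finset.sum_congr rfl fun J _ => ?_
  simp only [Fin.cons_succ]
  split_ifs
  · simp only [_root_.signSum, Finset.smul_sum, smul_smul, Fin.prod_univ_succ, Fin.cons_zero,
      Fin.cons_succ]
    refine Finset.sum_congr rfl fun j _ => ?_
    congr 1
    ring
  · simp

theorem SignSummable.mixedNorm_le {r q C M : ℝ} (hr : 1 ≤ r) (hrq : r ≤ q) (hC : 0 ≤ C)
    (hM : 0 ≤ M) (hF : CotypeOne q C F) {n : ℕ} :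
    ∀ {m : ℕ} {p : Fin (m + 1) → ℝ≥0∞} {k₀ : Fin (m + 1)},
      ∑ j, ((p j)⁻¹).toReal < 1 / r → 1 / r - 1 / q ≤ tailSum p k₀ →
      (∀ k, k₀ < k → tailSum p k < 1 / r - 1 / q) → ∀ {a : (Fin (m + 1) → Fin n) → F},
      SignSummable r (fun l => ((p l)⁻¹).toReal) M a →
        mixedNorm (m + 1) (hlExponent p r q k₀) (fun J => ‖a J‖) ≤ C ^ (m + 1) * M := by
  have hq : 1 ≤ q := hr.trans hrq
  have hq0 : 0 < q := by linarith
  have hr0 : 0 < r := by linarith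
  have hroot : ∀ {x D s : ℝ}, 0 ≤ x → 0 ≤ D → 0 < s → x ≤ D ^ s → x ^ (1 / s) ≤ D :=
    fun {x D s} hx hD hs h => by
      have := Real.rpow_le_rpow hx h (one_div_pos.2 hs).le
      rwa [← Real.rpow_mul hD, mul_one_div_cancel hs.ne', Real.rpow_one] at this
  intro m
  have base : ∀ {m : ℕ} {p : Fin (m + 1) → ℝ≥0∞},
      ∑ j, ((p j)⁻¹).toReal < 1 / r →
      (∀ k, 0 < k → tailSum p k < 1 / r - 1 / q) → ∀ {a : (Fin (m + 1) → Fin n) → F},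
      SignSummable r (fun l => ((p l)⁻¹).toReal) M a →
        mixedNorm (m + 1) (hlExponent p r q 0) (fun J => ‖a J‖) ≤ C ^ (m + 1) * M := by
    intro m p hupp hlt a ha
    -- Maximality of k₀ = 0, or r ≤ q for a single coordinate; it yields t ≤ q for t = (1/r - R)⁻¹.
    have hrest : ∑ l : Fin m, ((p l.succ)⁻¹).toReal ≤ 1 / r - 1 / q := by
      cases m with
      | zero =>
        have := one_div_le_one_div_of_le hr0 hrq
        simpa using this
      | succ m =>
        have := hlt (Fin.succ 0) (Fin.succ_pos 0)
        rw [tailSum_succ, tailSum_zero] at this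
        exact this.le
    have hq1 : 0 < 1 / q := by positivity
    set R := ∑ l : Fin m, ((p l.succ)⁻¹).toReal with hR
    have htot : tailSum p 0 = ((p 0)⁻¹).toReal + R := by
      rw [tailSum_zero, Fin.sum_univ_succ]
    have hupp' : tailSum p 0 < 1 / r := by rwa [tailSum_zero]
    have ht : 0 < (1 / r - R)⁻¹ := inv_pos.2 (by linarith)
    have hs : 0 < (1 / r - tailSum p 0)⁻¹ := inv_pos.2 (by linarith)
    have hb := SignSummable.sum_fst_le hr hq hC hM hF
      (P := fun l => ((p l)⁻¹).toReal) (fun l => ENNReal.toReal_nonneg) ht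
      (by rw [inv_le_comm₀ (by linarith) hq0, ← one_div]; linarith)
      (by rw [one_div, inv_inv]) hs
      (by rw [one_div (_⁻¹), inv_inv, one_div (_⁻¹), inv_inv, htot]; ring) ha
    have hs0 : hlExponent p r q 0 0 = (1 / r - tailSum p 0)⁻¹ := if_pos le_rfl
    have htl : Fin.tail (hlExponent p r q 0) = fun _ => q := by
      funext k
      simp only [Fin.tail, hlExponent, if_neg (not_le.2 (Fin.succ_pos k))]
    have hW : ∀ i, 0 ≤ ∑ J : Fin m → Fin n, ‖a (Fin.cons i J)‖ ^ q := fun i =>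
      Finset.sum_nonneg fun J _ => Real.rpow_nonneg (norm_nonneg _) _
    simp only [mixedNorm]
    rw [hs0, htl]
    simp only [mixedNorm_const hq0 fun J => norm_nonneg (a (Fin.cons _ J)),
      ← Real.rpow_mul (hW _), one_div_mul_eq_div]
    exact hroot (Finset.sum_nonneg fun i _ => Real.rpow_nonneg (hW i) _)
      (mul_nonneg (pow_nonneg hC _) hM) hs hb
  induction m with
  | zero =>
    intro p k₀ hupp hk₀ hlt a ha
    obtain rfl : k₀ = 0 := Subsingleton.elim (α := Fin 1) _ _
    exact base hupp hlt ha
  | succ m ih =>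
    intro p k₀ hupp hk₀ hlt a ha
    induction k₀ using Fin.cases with
    | zero => exact base hupp hlt ha
    | succ k₀ =>
      have htot : ∑ j, ((p j)⁻¹).toReal =
          ((p 0)⁻¹).toReal + ∑ j, ((Fin.tail p j)⁻¹).toReal := Fin.sum_univ_succ _
      have hp0 : 0 ≤ ((p 0)⁻¹).toReal := ENNReal.toReal_nonneg
      have hupp1 : ∑ j, ((Fin.tail p j)⁻¹).toReal < 1 / r := by linarith
      rw [tailSum_succ] at hk₀
      have hlt1 : ∀ k, k₀ < k → tailSum (Fin.tail p) k < 1 / r - 1 / q := fun k hk => by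
        rw [← tailSum_succ]
        exact hlt _ (Fin.succ_lt_succ_iff.2 hk)
      set s := hlExponent (Fin.tail p) r q k₀ with hs
      have hqs : ∀ i, q ≤ s i := le_hlExponent hq0 hupp1 hk₀
      have hanti : Antitone s := hlExponent_antitone hq0 hupp1 hk₀
      have hsig : s 0 = (1 / r - tailSum (Fin.tail p) 0)⁻¹ := if_pos (Fin.zero_le _)
      have hs0 : hlExponent p r q k₀.succ 0 = (1 / r - tailSum p 0)⁻¹ := if_pos (Fin.zero_le _)
      have hs0pos : 0 < hlExponent p r q k₀.succ 0 := by
        rw [hs0, tailSum_zero]; exact inv_pos.2 (by linarith)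
      have hsig0 : 0 < s 0 := hq0.trans_le (hqs 0)
      have hX : ∀ j, 0 ≤ mixedNorm (m + 1) s (fun J => ‖a (Fin.cons j J)‖) := fun j =>
        mixedNorm_nonneg _ fun _ => norm_nonneg _
      have hD : 0 ≤ C ^ (m + 1) * M := mul_nonneg (pow_nonneg hC _) hM
      have hD' : 0 ≤ C ^ (m + 1 + 1) * M := mul_nonneg (pow_nonneg hC _) hM
      -- For a fixed weight μ, cotype of the inner mixed norm reduces the sum over the first
      -- coordinate to sign sums, to which the induction hypothesis applies; duality then removes μ.
      have hdual := sum_rpow_le_of_forall_lpBall hp0 hsig0 hs0pos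
        (by rw [hs0, hsig, one_div (_⁻¹), inv_inv, one_div (_⁻¹), inv_inv, tailSum_zero,
              tailSum_zero, htot]; ring) hD'
        (X := fun j => mixedNorm (m + 1) s (fun J => ‖a (Fin.cons j J)‖) ^ s 0)
        (fun j => Real.rpow_nonneg (hX j) _) fun μ hμ => by
          have h1 := hF.mixedNorm hC hq hanti hqs (hqs 0) (fun i => hanti (Fin.zero_le i))
            (fun (j : Fin n) J => μ j • a (Fin.cons j J))
          simp only [norm_smul, Real.norm_eq_abs, abs_of_nonneg (hμ.1 _)] at h1
          simp only [mixedNorm_mul (hμ.1 _) (fun i => hq0.trans_le (hqs i))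
            (fun J => norm_nonneg (a (Fin.cons _ J))), Real.mul_rpow (hμ.1 _) (hX _)] at h1
          refine h1.trans ?_
          rw [pow_succ', mul_assoc, Real.mul_rpow hC hD]
          refine mul_le_mul_of_nonneg_left (Finset.expect_le Finset.univ_nonempty fun ε _ => ?_)
            (Real.rpow_nonneg hC _)
          exact Real.rpow_le_rpow (mixedNorm_nonneg _ fun _ => norm_nonneg _)
            (ih hupp1 hk₀ hlt1 (ha.signSum hμ ε)) hsig0.le
      simp only [← Real.rpow_mul (hX _), mul_div_cancel₀ _ hsig0.ne'] at hdual
      rw [_root_.mixedNorm, hlExponent_tail]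
      exact hroot (Finset.sum_nonneg fun j _ => Real.rpow_nonneg (hX j) _) hD' hs0pos hdual

end Main

/-! ### From summing operators to coefficient families -/

section Operators

variable {𝕜 : Type*} [RCLike 𝕜]

theorem norm_le_one_of_lpBall {n : ℕ} {p : ℝ≥0∞} [Fact (1 ≤ p)] {μ : Fin n → ℝ}
    (hμ : LpBall (p⁻¹).toReal μ) {x : PiLp p fun _ : Fin n => 𝕜} (hx : ∀ i, ‖x i‖ ≤ μ i) :
    ‖x‖ ≤ 1 := by
  have hp1 : 1 ≤ p := Fact.out
  by_cases hp : p = ⊤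
  · subst hp
    rw [PiLp.norm_eq_ciSup]
    exact Real.iSup_le (fun i => (hx i).trans (hμ.2.1 i)) zero_le_one
  · have hp0 : 0 < p.toReal := ENNReal.toReal_pos (by rintro rfl; simp at hp1) hp
    rw [PiLp.norm_eq_sum hp0]
    refine Real.rpow_le_one (Finset.sum_nonneg fun i _ => Real.rpow_nonneg (norm_nonneg _) _) ?_
      (by positivity)
    have h := hμ.2.2 (by rw [ENNReal.toReal_inv]; positivity)
    rw [ENNReal.toReal_inv, one_div, inv_inv] at h
    exact (Finset.sum_le_sum fun i _ => Real.rpow_le_rpow (norm_nonneg _) (hx i) hp0.le).trans h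

variable {E : Type*} [NormedAddCommGroup E] [NormedSpace 𝕜 E]
  {F : Type*} [NormedAddCommGroup F] [NormedSpace 𝕜 F]

theorem ContinuousMultilinearMap.apply_eq_sum_single {m n : ℕ} {p : Fin m → ℝ≥0∞}
    (A : ContinuousMultilinearMap 𝕜 (fun i : Fin m => PiLp (p i) (fun _ : Fin n => 𝕜)) E)
    (z : ∀ i, PiLp (p i) fun _ : Fin n => 𝕜) :
    A z = ∑ J : Fin m → Fin n, (∏ l, z l (J l)) • A fun l => PiLp.single (p l) (J l) (1 : 𝕜) := by
  have hz : z = fun l => ∑ j, z l j • PiLp.single (p l) j (1 : 𝕜) := by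
    funext l
    ext i
    simp [Pi.single_apply]
  conv_lhs => rw [hz]
  rw [A.map_sum]
  exact Finset.sum_congr rfl fun J _ => A.map_smul_univ _ _

/-- Scalars θ_i rotate each φ(x_i) to its modulus, so the sum of moduli is φ of a single
combination. -/
theorem weakNorm_one_le {n : ℕ} {x : Fin n → E} {B : ℝ} (hB : 0 ≤ B)
    (h : ∀ θ : Fin n → 𝕜, (∀ i, ‖θ i‖ ≤ 1) → ‖∑ i, θ i • x i‖ ≤ B) : weakNorm 𝕜 1 x ≤ B := by
  refine Real.iSup_le (fun φ => ?_) hB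
  simp only [Real.rpow_one, div_one]
  have hφ : ‖φ.1‖ ≤ 1 := mem_closedBall_zero_iff.1 φ.2
  choose θ hθ1 hθ using fun i => show ∃ c : 𝕜, ‖c‖ ≤ 1 ∧ c * φ.1 (x i) = (‖φ.1 (x i)‖ : 𝕜) from by
    obtain ⟨c, hc, hcx⟩ := RCLike.exists_norm_eq_mul_self (φ.1 (x i))
    exact ⟨c, hc.le, hcx.symm⟩
  have h1 : ((∑ i, ‖φ.1 (x i)‖ : ℝ) : 𝕜) = φ.1 (∑ i, θ i • x i) := by
    rw [map_sum, RCLike.ofReal_sum]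
    exact Finset.sum_congr rfl fun i _ => by rw [map_smul, smul_eq_mul, hθ]
  have h2 : ∑ i, ‖φ.1 (x i)‖ = ‖φ.1 (∑ i, θ i • x i)‖ := by
    rw [← h1, RCLike.norm_ofReal, abs_of_nonneg (Finset.sum_nonneg fun i _ => norm_nonneg _)]
  rw [h2]
  calc ‖φ.1 (∑ i, θ i • x i)‖ ≤ ‖φ.1‖ * ‖∑ i, θ i • x i‖ := φ.1.le_opNorm _
    _ ≤ 1 * B := mul_le_mul hφ (h θ hθ1) (norm_nonneg _) zero_le_one
    _ = B := one_mul B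

theorem summingNorm_nonneg (r p : ℝ) (v : E →L[𝕜] F) : 0 ≤ summingNorm r p v :=
  Real.sInf_nonneg fun _ h => h.1

theorem IsAbsolutelySumming.le_summingNorm_mul {r p : ℝ} {v : E →L[𝕜] F}
    (hv : IsAbsolutelySumming r p v) {n : ℕ} {x : Fin n → E} {B : ℝ} (hB : 0 ≤ B)
    (hx : weakNorm 𝕜 p x ≤ B) :
    (∑ j, ‖v (x j)‖ ^ r) ^ (1 / r) ≤ summingNorm r p v * B := by
  have h : ∀ C ∈ summingConstants r p v, (∑ j, ‖v (x j)‖ ^ r) ^ (1 / r) ≤ C * B :=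
    fun C hC => (hC.2 n x).trans (mul_le_mul_of_nonneg_left hx hC.1)
  -- Dividing by B to pass to the infimum needs B > 0.
  rcases hB.eq_or_lt with rfl | hB
  · obtain ⟨C, hC⟩ := hv
    simpa using h C hC
  · rw [← div_le_iff₀ hB]
    exact le_csInf hv fun C hC => (div_le_iff₀ hB).2 (h C hC)

theorem IsAbsolutelySumming.signSummable [NormedSpace ℝ F] [IsScalarTower ℝ 𝕜 F] {m n : ℕ}
    {p : Fin m → ℝ≥0∞} [∀ i, Fact (1 ≤ p i)] {r : ℝ} (hr : 0 < r)
    (A : ContinuousMultilinearMap 𝕜 (fun i : Fin m => PiLp (p i) (fun _ : Fin n => 𝕜)) E)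
    {v : E →L[𝕜] F} (hv : IsAbsolutelySumming r 1 v) :
    SignSummable r (fun l => ((p l)⁻¹).toReal) (summingNorm r 1 v * ‖A‖)
      fun J => v (A fun l => PiLp.single (p l) (J l) (1 : 𝕜)) := by
  intro μ hμ ε k
  set y : ∀ l, PiLp (p l) fun _ : Fin n => 𝕜 := fun l =>
    WithLp.toLp (p l) fun j => ((((ε l j : ℤ) : ℝ) * μ l j : ℝ) : 𝕜) with hy
  have hyn : ∀ l j, ‖y l j‖ ≤ μ l j := fun l j => by
    have hs : |((ε l j : ℤ) : ℝ)| = 1 := by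
      rcases Int.units_eq_one_or (ε l j) with h | h <;> simp [h]
    simp only [hy, RCLike.norm_ofReal]
    rw [abs_mul, hs, one_mul, abs_of_nonneg ((hμ l).1 j)]
  -- Multiplying the `x i` by θ_i and summing only changes the k-th argument to θ·y_k, which stays
  -- in the unit ball.
  set x : Fin n → E := fun i => A (Function.update y k (PiLp.single (p k) i (y k i))) with hx
  have hw : weakNorm 𝕜 1 x ≤ ‖A‖ := by
    refine weakNorm_one_le (norm_nonneg _) fun θ hθ => ?_
    have h1 : ∑ i, θ i • x i =
        A (Function.update y k (WithLp.toLp (p k) fun i => θ i * y k i)) := by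
      have h2 : (WithLp.toLp (p k) fun i => θ i * y k i : PiLp (p k) fun _ : Fin n => 𝕜) =
          ∑ i, θ i • PiLp.single (p k) i (y k i) := by
        ext j
        simp [Pi.single_apply]
      rw [h2]
      have h3 := map_sum (A.toMultilinearMap.toLinearMap y k)
        (fun i => θ i • PiLp.single (p k) i (y k i)) Finset.univ
      simp only [map_smul] at h3
      exact h3.symm
    rw [h1]
    refine (A.le_opNorm _).trans (mul_le_of_le_one_right (norm_nonneg _) ?_)
    refine Finset.prod_le_one (fun l _ => norm_nonneg _) fun l _ => ?_
    by_cases hl : l = k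
    · subst hl
      rw [Function.update_self]
      refine norm_le_one_of_lpBall (hμ l) fun i => ?_
      change ‖θ i * y l i‖ ≤ μ l i
      rw [norm_mul]
      exact (mul_le_of_le_one_left (norm_nonneg _) (hθ i)).trans (hyn l i)
    · rw [Function.update_of_ne hl]
      exact norm_le_one_of_lpBall (hμ l) (hyn l)
  have hvx : ∀ i, ∑ J : Fin m → Fin n with J k = i, (∏ l, ((ε l (J l) : ℤ) : ℝ) * μ l (J l)) •
      v (A fun l => PiLp.single (p l) (J l) (1 : 𝕜)) = v (x i) := fun i => by
    rw [hx]
    simp only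
    rw [A.apply_eq_sum_single, map_sum, Finset.sum_filter]
    refine Finset.sum_congr rfl fun J _ => ?_
    rw [map_smul]
    split_ifs with hJ
    · rw [RCLike.real_smul_eq_coe_smul (K := 𝕜), RCLike.ofReal_prod]
      congr 1
      refine Finset.prod_congr rfl fun l _ => ?_
      by_cases hl : l = k
      · subst hl
        rw [Function.update_self, hJ, PiLp.single_eq_same]
      · rw [Function.update_of_ne hl]
    · rw [Finset.prod_eq_zero (Finset.mem_univ k), zero_smul]
      rw [Function.update_self, PiLp.single_eq_of_ne _ hJ]
  simp only [hvx]
  have h0 : 0 ≤ ∑ i, ‖v (x i)‖ ^ r :=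
    Finset.sum_nonneg fun i _ => Real.rpow_nonneg (norm_nonneg _) _
  have h4 := Real.rpow_le_rpow (Real.rpow_nonneg h0 _)
    (hv.le_summingNorm_mul (norm_nonneg A) hw) hr.le
  rwa [← Real.rpow_mul h0, one_div_mul_cancel hr.ne', Real.rpow_one] at h4

end Operators

theorem mainTheorem2 {𝕜 : Type*} [RCLike 𝕜]
    {E : Type*} [NormedAddCommGroup E] [NormedSpace 𝕜 E] [CompleteSpace E]
    {F : Type*} [NormedAddCommGroup F] [NormedSpace 𝕜 F] [CompleteSpace F]
    {m : ℕ} (hm : 1 ≤ m) (p : Fin m → ℝ≥0∞) [∀ i, Fact (1 ≤ p i)]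
    {r q : ℝ} (hF : HasCotype q F) (hr : 1 ≤ r) (hrq : r ≤ q)
    (hlow : 1 / r - 1 / q ≤ ∑ j, ((p j)⁻¹).toReal)
    (hupp : ∑ j, ((p j)⁻¹).toReal < 1 / r) :
    ∃ k₀ : Fin m, IsGreatest {t : Fin m | 1 / r - 1 / q ≤ tailSum p t} k₀ ∧
      ∃ C : ℝ, ∀ (n : ℕ)
        (A : ContinuousMultilinearMap 𝕜 (fun i : Fin m => PiLp (p i) (fun _ : Fin n => 𝕜)) E)
        (v : E →L[𝕜] F), IsAbsolutelySumming r 1 v →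
          mixedNorm m (hlExponent p r q k₀)
              (fun js : Fin m → Fin n => ‖v (A (fun i => PiLp.single (p i) (js i) (1 : 𝕜)))‖) ≤
            C * ‖A‖ * summingNorm r 1 v := by
  obtain ⟨m, rfl⟩ : ∃ m', m = m' + 1 := ⟨m - 1, by omega⟩
  -- Signs and weights are real, so F is used as a real space from here on.
  let _ : NormedSpace ℝ F := NormedSpace.restrictScalars ℝ 𝕜 F
  have : IsScalarTower ℝ 𝕜 F := IsScalarTower.of_algebraMap_smul fun _ _ => rfl
  obtain ⟨C, hC, hcot⟩ := hF.exists_cotypeOne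
  obtain ⟨k₀, hk₀, hmax⟩ := Set.exists_max_image
    {t : Fin (m + 1) | 1 / r - 1 / q ≤ tailSum p t} id (Set.toFinite _)
    ⟨0, by rwa [← tailSum_zero] at hlow⟩
  refine ⟨k₀, ⟨hk₀, hmax⟩, C ^ (m + 1), fun n A v hv => ?_⟩
  have h := SignSummable.mixedNorm_le hr hrq hC
    (mul_nonneg (summingNorm_nonneg r 1 v) (norm_nonneg A)) hcot hupp hk₀
    (fun k hk => not_le.1 fun h => (hmax k h).not_gt hk)
    (hv.signSummable (by linarith) A)
  refine h.trans (le_of_eq ?_)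
  ring
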